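/- Let $u>0$ be real, and let $\zeta(s,u)$ be the Hurwitz zeta function, i.e. the meromorphic continuation in $s$ of $\sum_{k=0}^\infty (k+u)^{-s}$ ($\operatorname{Re} s>1$) to $\mathbb{C}\setminus\{1\}$. Let the Hurwitz–Stieltjes constants $\gamma_n(u)$, $n\ge 0$, be defined by the Laurent expansion at $s=1$ $$\zeta(s,u)=\frac{1}{s-1}+\sum_{n=0}^\infty \frac{(-1)^n}{n!}\,\gamma_n(u)\,(s-1)^n .$$ Then for every integer $n\ge 0$ the following integral converges absolutely, and $$\gamma_n(u)=\frac{\log^n u}{2u}-\frac{\log^{n+1}u}{n+1}+i\int_0^\infty \frac{(u-ix)\log^n(u+ix)-(u+ix)\log^n(u-ix)}{(u^2+x^2)\,(e^{2\pi x}-1)}\,dx ,$$ where $\log$ is the principal branch of the logarithm, $\log^n z=(\log z)^n$, and $\log^0 z=1$ for all $z$ (also for $z=1$). -/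

import Mathlib

open Complex Filter Topology Set MeasureTheory

/-- The Hurwitz zeta function `ζ(s, u)` for real `u > 0`: the meromorphic continuation in `s` of
`∑ k ≥ 0, 1 / (k + u) ^ s`. Mathlib's `HurwitzZeta.hurwitzZeta` is `1`-periodic in the parameter and
equals `ζ(s, a)` for the representative `a = u - (⌈u⌉ - 1)` in `(0, 1]`; the terms with
`a ≤ k + a < u`, i.e. `u - 1, u - 2, …, u - (⌈u⌉ - 1)`, have to be removed.
See `hasSum_hurwitzZetaReal` and `differentiableAt_hurwitzZetaReal`. -/
noncomputable def hurwitzZetaReal (u : ℝ) (s : ℂ) : ℂ :=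
  HurwitzZeta.hurwitzZeta (u : UnitAddCircle) s
    - ∑ k ∈ Finset.range (⌈u⌉₊ - 1), 1 / ((u - (k + 1) : ℝ) : ℂ) ^ s

/-- The regular part `ζ(s, u) - 1 / (s - 1)`, extended to `s = 1` by its limit there. -/
noncomputable def hurwitzZetaRegular (u : ℝ) : ℂ → ℂ :=
  Function.update (fun s : ℂ => hurwitzZetaReal u s - 1 / (s - 1)) 1
    (limUnder (𝓝[≠] (1 : ℂ)) fun s : ℂ => hurwitzZetaReal u s - 1 / (s - 1))

/-- The Hurwitz–Stieltjes constants `γ_n(u)`, normalised so that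
`ζ(s, u) = 1 / (s - 1) + ∑ n, (-1) ^ n / n! * γ_n(u) * (s - 1) ^ n`;
see `hasSum_stieltjesConst`. -/
noncomputable def stieltjesConst (n : ℕ) (u : ℝ) : ℂ :=
  (-1) ^ n * iteratedDeriv n (hurwitzZetaRegular u) 1

/-- For `Re s > 1`, `ζ(s, u)` is the usual Dirichlet series. -/
theorem hasSum_hurwitzZetaReal {u : ℝ} (hu : 0 < u) {s : ℂ} (hs : 1 < s.re) :
    HasSum (fun k : ℕ => 1 / ((k : ℂ) + u) ^ s) (hurwitzZetaReal u s) := by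
  obtain ⟨N, hN⟩ : ∃ N, ⌈u⌉₊ = N + 1 :=
    Nat.exists_eq_succ_of_ne_zero (Nat.ceil_pos.2 hu).ne'
  have h1 : u ≤ N + 1 := by
    have := Nat.le_ceil u
    rw [hN] at this
    exact_mod_cast this
  have h2 : (N : ℝ) < u := Nat.lt_ceil.1 (by omega)
  have ha : u - N ∈ Icc (0 : ℝ) 1 := ⟨by linarith, by linarith⟩
  have key := HurwitzZeta.hasSum_hurwitzZeta_of_one_lt_re ha hs
  have hcirc : ((u - N : ℝ) : UnitAddCircle) = (u : UnitAddCircle) := by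
    have : ((N : ℝ) : UnitAddCircle) = 0 := by
      have := AddCircle.coe_nsmul (p := (1 : ℝ)) (n := N) (x := 1)
      simpa [AddCircle.coe_period] using this
    rw [AddCircle.coe_sub, this, sub_zero]
  rw [hcirc, ← hasSum_nat_add_iff' N] at key
  have hsum : ∑ k ∈ Finset.range N, 1 / ((u - (k + 1) : ℝ) : ℂ) ^ s
      = ∑ i ∈ Finset.range N, 1 / ((i : ℂ) + ((u - N : ℝ) : ℂ)) ^ s := by
    rw [← Finset.sum_range_reflect]
    refine Finset.sum_congr rfl fun k hk => ?_
    have hk' : k + 1 ≤ N := Finset.mem_range.1 hk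
    have h3 : ((N - 1 - k : ℕ) : ℝ) = N - 1 - k := by
      rw [Nat.sub_sub, Nat.cast_sub (by omega)]
      push_cast
      ring
    rw [h3]
    congr 2
    push_cast
    ring
  unfold hurwitzZetaReal
  rw [hN, Nat.add_sub_cancel, hsum]
  convert! key using 1
  funext k
  congr 2
  push_cast
  ring

theorem differentiable_hurwitzZetaReal_finite (u : ℝ) :
    Differentiable ℂ fun s : ℂ =>
      ∑ k ∈ Finset.range (⌈u⌉₊ - 1), 1 / ((u - (k + 1) : ℝ) : ℂ) ^ s := by
  intro s
  refine DifferentiableAt.fun_sum fun k hk => ?_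
  have hk' : k + 1 < ⌈u⌉₊ := by
    have := Finset.mem_range.1 hk
    omega
  have hpos : (0 : ℝ) < u - (k + 1) := by
    have := Nat.lt_ceil.1 hk'
    push_cast at this
    linarith
  have hne : ((u - (k + 1) : ℝ) : ℂ) ≠ 0 := ofReal_ne_zero.2 hpos.ne'
  refine (differentiableAt_const _).div (differentiableAt_id.const_cpow (Or.inl hne)) ?_
  simp only [Ne, cpow_eq_zero_iff, not_and]
  exact fun h => absurd h hne

/-- `s ↦ ζ(s, u)` is holomorphic on `ℂ ∖ {1}`. -/
theorem differentiableAt_hurwitzZetaReal (u : ℝ) {s : ℂ} (hs : s ≠ 1) :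
    DifferentiableAt ℂ (hurwitzZetaReal u) s :=
  (HurwitzZeta.differentiableAt_hurwitzZeta _ hs).sub (differentiable_hurwitzZetaReal_finite u s)

theorem differentiable_hurwitzZetaRegular (u : ℝ) :
    Differentiable ℂ (hurwitzZetaRegular u) := by
  rw [← differentiableOn_univ]
  refine differentiableOn_update_limUnder_of_isLittleO univ_mem (fun s hs => ?_) ?_
  · have hs' : s ≠ 1 := hs.2
    exact ((differentiableAt_hurwitzZetaReal u hs').sub ((differentiableAt_const _).div
      (differentiableAt_id.sub_const _) (sub_ne_zero.2 hs'))).differentiableWithinAt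
  · rw [Asymptotics.isLittleO_iff_tendsto' ?_]
    · set c := hurwitzZetaReal u 1 - 1 / ((1 : ℂ) - 1) with hc
      have hz : Tendsto (fun s : ℂ => s - 1) (𝓝[≠] 1) (𝓝 0) := by
        have : Tendsto (fun s : ℂ => s - 1) (𝓝 1) (𝓝 (1 - 1)) := tendsto_id.sub_const _
        rw [sub_self] at this
        exact this.mono_left nhdsWithin_le_nhds
      have hF := ((differentiable_hurwitzZetaReal_finite u).continuous.tendsto 1).mono_left
        (nhdsWithin_le_nhds (s := {(1 : ℂ)}ᶜ))
      have hR := HurwitzZeta.hurwitzZeta_residue_one (u : UnitAddCircle)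
      have hT := ((hR.sub (hz.mul hF)).sub (tendsto_const_nhds (x := (1 : ℂ)))).sub
        (hz.mul (tendsto_const_nhds (x := c)))
      simp only [zero_mul, sub_zero, sub_self] at hT
      refine hT.congr' ?_
      filter_upwards [self_mem_nhdsWithin] with s hs
      have hs' : s - 1 ≠ 0 := sub_ne_zero.2 hs
      simp only [hurwitzZetaReal]
      rw [div_inv_eq_mul]
      have : 1 / (s - 1) * (s - 1) = 1 := by field_simp
      linear_combination this
    · filter_upwards [self_mem_nhdsWithin] with s hs h
      exact absurd h (inv_ne_zero (sub_ne_zero.2 hs))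

/-- The Laurent expansion of `ζ(s, u)` at `s = 1`. -/
theorem hasSum_stieltjesConst (u : ℝ) {s : ℂ} (hs : s ≠ 1) :
    HasSum (fun n : ℕ => (-1) ^ n / (n.factorial : ℂ) * stieltjesConst n u * (s - 1) ^ n)
      (hurwitzZetaReal u s - 1 / (s - 1)) := by
  have h := hasSum_taylorSeries_of_entire (differentiable_hurwitzZetaRegular u) 1 s
  have h1 : hurwitzZetaRegular u s = hurwitzZetaReal u s - 1 / (s - 1) := by
    simp [hurwitzZetaRegular, Function.update_of_ne hs]
  rw [h1] at h
  convert! h using 1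
  funext n
  have h2 : ((-1 : ℂ) ^ n) * (-1) ^ n = 1 := by
    rw [← mul_pow]
    simp
  simp only [stieltjesConst, smul_eq_mul]
  linear_combination (iteratedDeriv n (hurwitzZetaRegular u) 1 * (s - 1) ^ n
    / (n.factorial : ℂ)) * h2

/-! The formula comes from Hermite's integral ζ(s,u) = u^(-s)/2 + u^(1-s)/(s-1) + i ∫ ((u+ix)^(-s) -
(u-ix)^(-s))/(e^(2πx)-1) dx by reading off Taylor coefficients at s = 1.

For Re s > 1, Γ(s)ζ(s,u) is the Mellin transform of e^(-ut)/(1-e^(-t))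
(`Gamma_mul_hurwitzZetaReal`). Legendre's integral (`integral_sin_div_exp_sub_one`) splits
1/(1-e^(-t)) into 1/2 + 1/t + 2∫ sin(tx)/(e^(2πx)-1) dx; after Fubini, each piece is a Mellin
transform of exponentials with complex rate.

The integral in Hermite's formula is entire in s, thanks to a bound uniform on discs
(`exists_norm_hermiteKernel_le`). Multiplied by s-1, the formula therefore extends to all of ℂ, and
differentiating it n+1 times at s = 1 gives the n-th Taylor coefficient of the regular part. -/

/-! ### Mellin transforms of exponentials with complex rate -/

theorem integrableOn_rpow_mul_exp_neg {a b : ℝ} (ha : -1 < a) (hb : 0 < b) :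
    IntegrableOn (fun t : ℝ => t ^ a * Real.exp (-b * t)) (Ioi 0) := by
  simpa using integrableOn_rpow_mul_exp_neg_mul_rpow ha one_pos hb

theorem continuousOn_ofReal_cpow_mul_exp (a r : ℂ) :
    ContinuousOn (fun t : ℝ => (t : ℂ) ^ a * cexp (-(r * t))) (Ioi 0) := by
  refine ContinuousOn.mul (fun t ht => ?_) (by fun_prop)
  exact (Complex.continuousAt_ofReal_cpow_const t a (Or.inr (ne_of_gt ht))).continuousWithinAt

theorem norm_ofReal_cpow_mul_exp (a r : ℂ) {t : ℝ} (ht : 0 < t) :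
    ‖(t : ℂ) ^ a * cexp (-(r * t))‖ = t ^ a.re * Real.exp (-r.re * t) := by
  rw [norm_mul, Complex.norm_cpow_eq_rpow_re_of_pos ht, Complex.norm_exp]
  simp

theorem integrableOn_cpow_mul_exp_neg {a r : ℂ} (ha : -1 < a.re) (hr : 0 < r.re) :
    IntegrableOn (fun t : ℝ => (t : ℂ) ^ a * cexp (-(r * t))) (Ioi 0) := by
  refine Integrable.mono' (integrableOn_rpow_mul_exp_neg ha hr)
    ((continuousOn_ofReal_cpow_mul_exp a r).aestronglyMeasurable measurableSet_Ioi) ?_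
  filter_upwards [ae_restrict_mem measurableSet_Ioi] with t ht
  exact (norm_ofReal_cpow_mul_exp a r ht).le

theorem hasDerivAt_integral_cpow_mul_exp_neg {a r : ℂ} (ha : -1 < a.re) (hr : 0 < r.re) :
    HasDerivAt (fun r : ℂ => ∫ t : ℝ in Ioi 0, (t : ℂ) ^ a * cexp (-(r * t)))
      (∫ t : ℝ in Ioi 0, -((t : ℂ) ^ (a + 1) * cexp (-(r * t)))) r := by
  refine (hasDerivAt_integral_of_dominated_loc_of_deriv_le
    (F := fun (r : ℂ) (t : ℝ) => (t : ℂ) ^ a * cexp (-(r * t)))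
    (F' := fun (r : ℂ) (t : ℝ) => -((t : ℂ) ^ (a + 1) * cexp (-(r * t))))
    -- On the ball of radius Re r / 2 about r, real parts stay at least Re r / 2.
    (bound := fun t : ℝ => t ^ (a.re + 1) * Real.exp (-(r.re / 2) * t))
    (Metric.ball_mem_nhds r (half_pos hr)) ?_ (integrableOn_cpow_mul_exp_neg ha hr) ?_ ?_
    (integrableOn_rpow_mul_exp_neg (by linarith) (half_pos hr)) ?_).2
  · exact Eventually.of_forall fun r =>
      (continuousOn_ofReal_cpow_mul_exp a r).aestronglyMeasurable measurableSet_Ioi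
  · exact ((continuousOn_ofReal_cpow_mul_exp _ r).aestronglyMeasurable measurableSet_Ioi).neg
  · filter_upwards [ae_restrict_mem measurableSet_Ioi] with t ht z hz
    have ht' : 0 < t := ht
    rw [norm_neg, norm_ofReal_cpow_mul_exp _ _ ht]
    have h1 : |(z - r).re| < r.re / 2 :=
      (Complex.abs_re_le_norm _).trans_lt (by simpa [dist_eq_norm] using hz)
    have h2 : r.re / 2 ≤ z.re := by
      have := (abs_lt.1 h1).1
      simp only [sub_re] at this
      linarith
    simp only [add_re, one_re]
    gcongr
  · filter_upwards [ae_restrict_mem measurableSet_Ioi] with t ht z hz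
    have ht' : (t : ℂ) ≠ 0 := ofReal_ne_zero.2 (ne_of_gt ht)
    have h : HasDerivAt (fun z : ℂ => -(z * t)) (-(1 * t)) z :=
      ((hasDerivAt_id z).mul_const (t : ℂ)).fun_neg
    convert! h.cexp.const_mul ((t : ℂ) ^ a) using 1
    rw [cpow_add _ _ ht', cpow_one]
    ring

/-- The Mellin transform of `t ↦ exp (-r t)` for complex `r` with positive real part. -/
theorem integral_cpow_mul_exp_neg_mul_complex {a r : ℂ} (ha : 0 < a.re) (hr : 0 < r.re) :
    ∫ t : ℝ in Ioi 0, (t : ℂ) ^ (a - 1) * cexp (-(r * t)) =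
      cexp (-(a * Complex.log r)) * Gamma a := by
  have ho : IsOpen {z : ℂ | 0 < z.re} := isOpen_lt continuous_const continuous_re
  have h1 : AnalyticOnNhd ℂ
      (fun r : ℂ => ∫ t : ℝ in Ioi 0, (t : ℂ) ^ (a - 1) * cexp (-(r * t))) {z | 0 < z.re} := by
    refine DifferentiableOn.analyticOnNhd (fun z hz => ?_) ho
    exact (hasDerivAt_integral_cpow_mul_exp_neg (by simpa using ha)
      hz).differentiableAt.differentiableWithinAt
  have h2 : AnalyticOnNhd ℂ (fun r : ℂ => cexp (-(a * Complex.log r)) * Gamma a)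
      {z | 0 < z.re} := by
    refine DifferentiableOn.analyticOnNhd (fun z hz => ?_) ho
    have : DifferentiableAt ℂ Complex.log z := Complex.differentiableAt_log (Or.inl hz)
    exact (((this.const_mul a).neg.cexp).mul_const _).differentiableWithinAt
  have hc : IsPreconnected {z : ℂ | 0 < z.re} := (convex_halfSpace_re_gt 0).isPreconnected
  refine h1.eqOn_of_preconnected_of_frequently_eq h2 hc (z₀ := 1) (by simp) ?_ hr
  -- The real points 1 + 1/(n+1) accumulate at 1; there the known formula for real rates applies.
  have ht : Tendsto (fun n : ℕ => (1 : ℂ) + 1 / ((n : ℂ) + 1)) atTop (𝓝[≠] 1) := by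
    refine tendsto_nhdsWithin_iff.2 ⟨?_, Eventually.of_forall fun n => ?_⟩
    · simpa using tendsto_one_div_add_atTop_nhds_zero_nat (𝕜 := ℂ) |>.const_add 1
    · have : (n : ℂ) + 1 ≠ 0 := Nat.cast_add_one_ne_zero n
      simpa using this
  refine ht.frequently (Frequently.of_forall fun n => ?_)
  have hp : (0 : ℝ) < 1 + 1 / ((n : ℝ) + 1) := by positivity
  have h := Complex.integral_cpow_mul_exp_neg_mul_Ioi ha hp
  push_cast at h
  rw [h, one_div, inv_cpow, ← cpow_neg, cpow_def_of_ne_zero]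
  · congr 2
    ring
  · have h0 := ofReal_ne_zero.2 hp.ne'
    push_cast at h0
    exact h0
  · have : (1 : ℂ) + 1 / ((n : ℂ) + 1) = ((1 + 1 / ((n : ℝ) + 1) : ℝ) : ℂ) := by push_cast; rfl
    rw [this, arg_ofReal_of_nonneg hp.le]
    exact Real.pi_pos.ne

/-! ### Legendre's integral -/

/-- This is y ≤ sinh y times 2e^y. The factor y absorbs the zero of the denominator e^(2πx)-1 at x =
0, and e^y keeps exponential decay. -/
theorem mul_exp_le_exp_two_mul_sub_one {y : ℝ} (hy : 0 ≤ y) :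
    2 * y * Real.exp y ≤ Real.exp (2 * y) - 1 := by
  have h := Real.self_le_sinh_iff.2 hy
  rw [Real.sinh_eq] at h
  have h1 : Real.exp y * Real.exp (-y) = 1 := by rw [← Real.exp_add]; simp
  have h2 : Real.exp (2 * y) = Real.exp y * Real.exp y := by rw [← Real.exp_add]; ring_nf
  nlinarith [mul_le_mul_of_nonneg_right h (Real.exp_pos y).le]

theorem norm_exp_two_pi_mul_sub_one {x : ℝ} (hx : 0 < x) :
    ‖cexp (2 * Real.pi * x) - 1‖ = Real.exp (2 * Real.pi * x) - 1 := by
  have h : cexp (2 * Real.pi * x) - 1 = ((Real.exp (2 * Real.pi * x) - 1 : ℝ) : ℂ) := by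
    push_cast; rfl
  rw [h, norm_real, Real.norm_of_nonneg]
  rw [sub_nonneg]
  exact Real.one_le_exp (by positivity)

theorem exp_two_pi_mul_sub_one_ne_zero {x : ℝ} (hx : 0 < x) : cexp (2 * Real.pi * x) - 1 ≠ 0 := by
  rw [← norm_ne_zero_iff, norm_exp_two_pi_mul_sub_one hx, sub_ne_zero]
  exact (Real.one_lt_exp_iff.2 (by positivity)).ne'

theorem norm_div_exp_two_pi_mul_sub_one_le {x C : ℝ} {w : ℂ} (hx : 0 < x) (hw : ‖w‖ ≤ C * x) :
    ‖w / (cexp (2 * Real.pi * x) - 1)‖ ≤ C * Real.exp (-Real.pi * x) := by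
  have h := mul_exp_le_exp_two_mul_sub_one (y := Real.pi * x) (by positivity)
  have hC : 0 ≤ C := nonneg_of_mul_nonneg_left ((norm_nonneg w).trans hw) hx
  have h1 : 1 < Real.exp (2 * Real.pi * x) := Real.one_lt_exp_iff.2 (by positivity)
  have h2 : Real.exp (-Real.pi * x) * Real.exp (Real.pi * x) = 1 := by
    rw [← Real.exp_add]; simp
  rw [norm_div, norm_exp_two_pi_mul_sub_one hx, div_le_iff₀ (by linarith)]
  refine hw.trans ?_
  rw [mul_assoc C]
  refine mul_le_mul_of_nonneg_left ?_ hC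
  rw [← mul_assoc 2 Real.pi x] at h
  calc x ≤ 2 * Real.pi * x := by nlinarith [Real.pi_gt_three]
    _ = Real.exp (-Real.pi * x) * (2 * Real.pi * x * Real.exp (Real.pi * x)) := by
      linear_combination -(2 * Real.pi * x) * h2
    _ ≤ _ := mul_le_mul_of_nonneg_left h (Real.exp_pos _).le

theorem norm_sin_ofReal_mul_le {t x : ℝ} (ht : 0 < t) (hx : 0 < x) :
    ‖Complex.sin (t * x)‖ ≤ t * x := by
  rw [← ofReal_mul, ← ofReal_sin, norm_real, Real.norm_eq_abs]
  exact Real.abs_sin_le_abs.trans_eq (abs_of_pos (by positivity))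

theorem sin_mul_exp_neg_eq (t c x : ℂ) :
    Complex.sin (t * x) * cexp (-(c * x)) =
      I / 2 * (cexp (-(c + I * t) * x) - cexp (-(c - I * t) * x)) := by
  have h1 : cexp (-(c + I * t) * x) = cexp (-(t * x) * I) * cexp (-(c * x)) := by
    rw [← Complex.exp_add]; ring_nf
  have h2 : cexp (-(c - I * t) * x) = cexp (t * x * I) * cexp (-(c * x)) := by
    rw [← Complex.exp_add]; ring_nf
  rw [h1, h2, Complex.sin]
  ring

theorem integral_sin_mul_exp_neg (t : ℝ) {c : ℝ} (hc : 0 < c) :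
    ∫ x : ℝ in Ioi 0, Complex.sin (t * x) * cexp (-(c * x)) =
      I / 2 * (1 / (c + I * t) - 1 / (c - I * t)) := by
  simp_rw [sin_mul_exp_neg_eq]
  have h1 : (-((c : ℂ) + I * t)).re < 0 := by simpa using hc
  have h2 : (-((c : ℂ) - I * t)).re < 0 := by simpa using hc
  rw [integral_const_mul, integral_sub (integrableOn_exp_mul_complex_Ioi h1 0)
    (integrableOn_exp_mul_complex_Ioi h2 0), integral_exp_mul_complex_Ioi h1,
    integral_exp_mul_complex_Ioi h2]
  simp only [ofReal_zero, mul_zero, Complex.exp_zero, neg_div_neg_eq]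

theorem integrableOn_sin_mul_exp_neg (t : ℝ) {c : ℝ} (hc : 0 < c) :
    IntegrableOn (fun x : ℝ => Complex.sin (t * x) * cexp (-(c * x))) (Ioi 0) := by
  simp_rw [sin_mul_exp_neg_eq]
  have h1 : (-((c : ℂ) + I * t)).re < 0 := by simpa using hc
  have h2 : (-((c : ℂ) - I * t)).re < 0 := by simpa using hc
  exact ((integrableOn_exp_mul_complex_Ioi h1 0).sub
    (integrableOn_exp_mul_complex_Ioi h2 0)).const_mul _

/-- From |sin(tx)| ≤ tx. With c = 2π(k+1) the bound is summable in k, whereas |sin| ≤ 1 would only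
give the harmonic series. -/
theorem integral_norm_sin_mul_exp_neg_le {t c : ℝ} (ht : 0 < t) (hc : 0 < c) :
    ∫ x : ℝ in Ioi 0, ‖Complex.sin (t * x) * cexp (-(c * x))‖ ≤ t * (1 / c ^ 2) := by
  have h1 := Real.integral_rpow_mul_exp_neg_mul_Ioi (a := 2) two_pos hc
  have h2 := integrableOn_rpow_mul_exp_neg (a := 1) (by norm_num) hc
  have h3 : Real.Gamma 2 = 1 := Real.Gamma_two
  rw [h3, mul_one, Real.rpow_two, one_div_pow] at h1
  norm_num at h1
  simp only [Real.rpow_one] at h2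
  rw [one_div, ← h1, ← integral_const_mul]
  refine setIntegral_mono_on (integrableOn_sin_mul_exp_neg t hc).norm ?_ measurableSet_Ioi
    fun x hx => ?_
  · simp only [neg_mul] at h2
    exact h2.const_mul t
  · have h4 : ‖cexp (-(c * x))‖ = Real.exp (-(c * x)) := by
      rw [Complex.norm_exp]; simp
    rw [norm_mul, h4, ← mul_assoc]
    exact mul_le_mul_of_nonneg_right (norm_sin_ofReal_mul_le ht hx) (Real.exp_pos _).le

theorem hasSum_sin_mul_exp_neg (w : ℂ) {x : ℝ} (hx : 0 < x) :
    HasSum (fun k : ℕ => w * cexp (-((2 * Real.pi * (k + 1) : ℝ) * x)))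
      (w / (cexp (2 * Real.pi * x) - 1)) := by
  set q := cexp (-(2 * Real.pi * x)) with hq
  have hq1 : ‖q‖ < 1 := by
    rw [hq, Complex.norm_exp]
    simpa using by positivity
  have hq0 : q * cexp (2 * Real.pi * x) = 1 := by rw [hq, ← Complex.exp_add]; simp
  have hne := exp_two_pi_mul_sub_one_ne_zero hx
  have hne' : 1 - q ≠ 0 := sub_ne_zero.2 fun h => by simp [← h] at hq1
  convert! (hasSum_geometric_of_norm_lt_one hq1).mul_left (w * q) using 1
  · funext k
    rw [mul_assoc w q, ← pow_succ', hq, ← Complex.exp_nat_mul]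
    congr 2
    push_cast
    ring
  · field_simp
    linear_combination -w * hq0

/-- Legendre's integral for `1 / (1 - exp (-t))`. -/
theorem integral_sin_div_exp_sub_one {t : ℝ} (ht : 0 < t) :
    ∫ x : ℝ in Ioi 0, Complex.sin (t * x) / (cexp (2 * Real.pi * x) - 1) =
      1 / (2 * (1 - cexp (-t))) - 1 / 4 - 1 / (2 * t) := by
  have hc : ∀ k : ℕ, 0 < 2 * Real.pi * ((k : ℝ) + 1) := fun k => by positivity
  have hpi : (Real.pi : ℂ) ≠ 0 := ofReal_ne_zero.2 Real.pi_ne_zero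
  have htne : (t : ℂ) ≠ 0 := ofReal_ne_zero.2 ht.ne'
  have hsum : Summable fun k : ℕ =>
      ∫ x : ℝ in Ioi 0, ‖Complex.sin (t * x) * cexp (-((2 * Real.pi * (k + 1) : ℝ) * x))‖ := by
    refine Summable.of_nonneg_of_le (fun k => integral_nonneg fun x => norm_nonneg _)
      (fun k => integral_norm_sin_mul_exp_neg_le ht (hc k)) ?_
    have h := ((summable_nat_add_iff 1).2
      (Real.summable_one_div_nat_pow.2 (by norm_num : 1 < 2))).mul_left (t * (1 / (2 * Real.pi) ^ 2))
    refine h.congr fun k => ?_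
    push_cast
    rw [mul_pow (2 * Real.pi)]
    field_simp
  have key := hasSum_integral_of_summable_integral_norm
    (fun k => integrableOn_sin_mul_exp_neg t (hc k)) hsum
  rw [setIntegral_congr_fun measurableSet_Ioi fun (x : ℝ) hx =>
    (hasSum_sin_mul_exp_neg (Complex.sin (t * x)) hx).tsum_eq] at key
  simp_rw [fun k => integral_sin_mul_exp_neg t (hc k)] at key
  -- At z = it/(2π) one has e^(2πiz) = e^(-t). Comparing the partial fractions of π cot(πz) with its
  -- expansion in powers of e^(2πiz) evaluates the series.
  have hz : 0 < (I * t / (2 * Real.pi)).im := by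
    have : I * t / (2 * Real.pi) = ((t / (2 * Real.pi) : ℝ) : ℂ) * I := by push_cast; ring
    rw [this, im_ofReal_mul, I_im, mul_one]
    positivity
  set z : UpperHalfPlane := ⟨I * t / (2 * Real.pi), hz⟩ with hzdef
  have hzc : (z : ℂ) = I * t / (2 * Real.pi) := rfl
  have hcot := cot_series_rep' z.coe_mem_integerComplement
  rw [pi_mul_cot_pi_q_exp] at hcot
  have hexp : cexp (2 * Real.pi * I * z) = cexp (-t) := by
    congr 1
    rw [hzc]
    field_simp
    linear_combination I_sq
  have hq1 : ‖cexp (-(t : ℂ))‖ < 1 := by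
    rw [Complex.norm_exp]
    simpa using ht
  have hne' : 1 - cexp (-(t : ℂ)) ≠ 0 := sub_ne_zero.2 fun h => by simp [← h] at hq1
  rw [hexp, tsum_geometric_of_norm_lt_one hq1] at hcot
  rw [← key.tsum_eq]
  have hterm : ∀ k : ℕ, I / 2 * (1 / (((2 * Real.pi * (k + 1) : ℝ) : ℂ) + I * t)
      - 1 / (((2 * Real.pi * (k + 1) : ℝ) : ℂ) - I * t)) =
      I / (4 * Real.pi) * (1 / ((z : ℂ) - (k + 1)) + 1 / ((z : ℂ) + (k + 1))) := fun k => by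
    have e1 : (z : ℂ) - (k + 1)
        = -(((2 * Real.pi * (k + 1) : ℝ) : ℂ) - I * t) / (2 * Real.pi) := by
      rw [hzc]; push_cast; field_simp; ring
    have e2 : (z : ℂ) + (k + 1)
        = (((2 * Real.pi * (k + 1) : ℝ) : ℂ) + I * t) / (2 * Real.pi) := by
      rw [hzc]; push_cast; field_simp; ring
    rw [e1, e2, one_div_div, one_div_div, div_neg]
    field_simp
    ring
  rw [tsum_congr hterm, tsum_mul_left, ← hcot, hzc]
  field_simp
  linear_combination (-2 * (t : ℂ) * (1 + cexp (-t))) * I_sq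

/-! ### The Hermite kernel: bounds and differentiation in s -/

/-- The `n`-th `s`-derivative, up to sign, of the integrand of Hermite's formula for `ζ(s, u)`. -/
noncomputable def hermiteKernel (u : ℝ) (n : ℕ) (s : ℂ) (x : ℝ) : ℂ :=
  (Complex.log (u + I * x) ^ n * cexp (-(s * Complex.log (u + I * x)))
    - Complex.log (u - I * x) ^ n * cexp (-(s * Complex.log (u - I * x))))
    / (cexp (2 * Real.pi * x) - 1)

/-- Mean value inequality: the derivative 1/z is bounded by 1/u on the convex half-plane Re z ≥ u.
-/
theorem norm_log_sub_log_le {u : ℝ} (hu : 0 < u) {z w : ℂ} (hz : u ≤ z.re) (hw : u ≤ w.re) :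
    ‖Complex.log z - Complex.log w‖ ≤ 1 / u * ‖z - w‖ := by
  refine (convex_halfSpace_re_ge u).norm_image_sub_le_of_norm_hasDerivWithin_le
    (f' := fun z => z⁻¹) (fun z hz => ?_) (fun z hz => ?_) hw hz
  · exact (Complex.hasDerivAt_log (Or.inl (hu.trans_le hz))).hasDerivWithinAt
  · rw [norm_inv, one_div]
    exact inv_anti₀ hu (le_trans hz (Complex.re_le_norm z))

theorem exp_norm_log_le {z : ℂ} (hz : z ≠ 0) :
    Real.exp ‖Complex.log z‖ ≤ Real.exp Real.pi * (‖z‖ + ‖z‖⁻¹) := by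
  have h0 : 0 < ‖z‖ := norm_pos_iff.2 hz
  have h1 : ‖Complex.log z‖ ≤ Real.pi + |Real.log ‖z‖| := by
    refine (Complex.norm_le_abs_re_add_abs_im _).trans ?_
    rw [Complex.log_re, Complex.log_im, add_comm]
    gcongr
    exact Complex.abs_arg_le_pi z
  refine (Real.exp_le_exp.2 h1).trans ?_
  rw [Real.exp_add]
  gcongr
  rcases abs_cases (Real.log ‖z‖) with h | h
  · rw [h.1, Real.exp_log h0]
    exact le_add_of_nonneg_right (by positivity)
  · rw [h.1, Real.exp_neg, Real.exp_log h0]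
    exact le_add_of_nonneg_left h0.le

theorem pow_le_factorial_mul_exp {x : ℝ} (hx : 0 ≤ x) (n : ℕ) :
    x ^ n ≤ n.factorial * Real.exp x := by
  have := Real.pow_div_factorial_le_exp x hx n
  rwa [div_le_iff₀' (by positivity)] at this

/-- Mean value inequality on the disc of radius M. Powers of w are absorbed by x^n ≤ n! e^x, whence
R + 1 rather than R in the exponent. -/
theorem norm_pow_mul_exp_sub_le (n : ℕ) {s a b : ℂ} {R M : ℝ} (hs : ‖s‖ ≤ R) (ha : ‖a‖ ≤ M)
    (hb : ‖b‖ ≤ M) :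
    ‖a ^ n * cexp (-(s * a)) - b ^ n * cexp (-(s * b))‖ ≤
      (1 + R) * n.factorial * Real.exp ((R + 1) * M) * ‖a - b‖ := by
  have hM : 0 ≤ M := (norm_nonneg a).trans ha
  have hR : 0 ≤ R := (norm_nonneg s).trans hs
  refine (convex_closedBall (0 : ℂ) M).norm_image_sub_le_of_norm_hasDerivWithin_le
    (f := fun w => w ^ n * cexp (-(s * w)))
    (f' := fun w => (n * w ^ (n - 1)) * cexp (-(s * w)) + w ^ n * (cexp (-(s * w)) * (-(s * 1))))
    (fun w hw => ?_) (fun w hw => ?_) (by simpa using hb) (by simpa using ha)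
  · exact ((hasDerivAt_pow n w).mul
      (((hasDerivAt_id w).const_mul s).fun_neg.cexp)).hasDerivWithinAt
  · have hw' : ‖w‖ ≤ M := by simpa using hw
    have he : ‖cexp (-(s * w))‖ ≤ Real.exp (R * M) := by
      refine (Complex.norm_exp_le_exp_norm _).trans (Real.exp_le_exp.2 ?_)
      rw [norm_neg, norm_mul]
      gcongr
    have h1 : (n : ℝ) * ‖w‖ ^ (n - 1) ≤ n.factorial * Real.exp M := by
      rcases n with _ | n
      · simp [Real.exp_nonneg]
      · rw [Nat.add_sub_cancel, Nat.factorial_succ, Nat.cast_mul, mul_assoc]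
        gcongr
        exact (pow_le_factorial_mul_exp (norm_nonneg w) n).trans (by gcongr)
    have h2 : ‖w‖ ^ n ≤ n.factorial * Real.exp M :=
      (pow_le_factorial_mul_exp (norm_nonneg w) n).trans (by gcongr)
    calc _ ≤ (n * ‖w‖ ^ (n - 1)) * ‖cexp (-(s * w))‖ + ‖w‖ ^ n * (‖cexp (-(s * w))‖ * ‖s‖) := by
          refine (norm_add_le _ _).trans (le_of_eq ?_)
          simp
      _ ≤ (n.factorial * Real.exp M) * Real.exp (R * M)
          + (n.factorial * Real.exp M) * (Real.exp (R * M) * R) := by gcongr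
      _ = _ := by
          rw [add_mul R 1 M, Real.exp_add, one_mul]
          ring

/-- The two logarithms differ by at most 2x/u, which cancels the pole at x = 0. The remaining factor
grows polynomially in x and is absorbed in e^x, against the decay e^(-πx) from the denominator. -/
theorem exists_norm_hermiteKernel_le {u : ℝ} (hu : 0 < u) (n : ℕ) (R : ℝ) :
    ∃ C : ℝ, ∀ s : ℂ, ‖s‖ ≤ R → ∀ x : ℝ, 0 < x →
      ‖hermiteKernel u n s x‖ ≤ C * Real.exp (-(Real.pi - 1) * x) := by
  -- A natural exponent N ≥ R + 1 lets (1+x)^N be bounded by N! e^(1+x).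
  obtain ⟨N, hN⟩ := exists_nat_ge (R + 1)
  set A := Real.exp Real.pi * (u + u⁻¹ + 1) with hA
  have hA0 : 0 < A := by positivity
  refine ⟨(1 + R) * n.factorial * (A ^ N * (N.factorial * Real.exp 1)) * (1 / u * 2),
    fun s hs x hx => ?_⟩
  have hR : 0 ≤ R := (norm_nonneg s).trans hs
  -- Allowing y = ±x treats u + ix and u - ix together.
  have hlog : ∀ y : ℝ, |y| = x → ‖Complex.log (u + I * y)‖ ≤ Real.log (A * (1 + x)) := fun y hy => by
    have hre : (u + I * y : ℂ).re = u := by simp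
    have hz : (u + I * y : ℂ) ≠ 0 := fun h => by simp [h] at hre; exact hu.ne hre
    have h1 : u ≤ ‖(u + I * y : ℂ)‖ := by
      have := Complex.re_le_norm (u + I * y)
      rwa [hre] at this
    have h2 : ‖(u + I * y : ℂ)‖ ≤ u + x := by
      refine (norm_add_le _ _).trans (le_of_eq ?_)
      simp [hy, abs_of_pos hu]
    rw [Real.le_log_iff_exp_le (by positivity)]
    refine (exp_norm_log_le hz).trans ?_
    rw [hA, mul_assoc]
    have h3 : ‖(u + I * y : ℂ)‖⁻¹ ≤ u⁻¹ := inv_anti₀ hu h1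
    have h4 : 0 < u⁻¹ := by positivity
    gcongr
    nlinarith
  have ha := hlog x (abs_of_pos hx)
  have hb : ‖Complex.log (u - I * x)‖ ≤ Real.log (A * (1 + x)) := by
    simpa [sub_eq_add_neg] using hlog (-x) (by rw [abs_neg, abs_of_pos hx])
  have hab : ‖Complex.log (u + I * x) - Complex.log (u - I * x)‖ ≤ 1 / u * 2 * x := by
    refine (norm_log_sub_log_le hu (by simp) (by simp)).trans (le_of_eq ?_)
    have : (u + I * x : ℂ) - (u - I * x) = 2 * I * x := by ring
    rw [this]
    simp [abs_of_pos hx, mul_assoc]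
  have hexp : Real.exp ((R + 1) * Real.log (A * (1 + x))) ≤
      A ^ N * (N.factorial * Real.exp 1) * Real.exp x := by
    have hlog0 : 0 ≤ Real.log (A * (1 + x)) := (norm_nonneg _).trans ha
    calc _ ≤ Real.exp (N * Real.log (A * (1 + x))) := by gcongr
      _ = A ^ N * (1 + x) ^ N := by
          rw [Real.exp_nat_mul, Real.exp_log (by positivity), mul_pow]
      _ ≤ A ^ N * (N.factorial * Real.exp (1 + x)) := by
          gcongr
          exact pow_le_factorial_mul_exp (by positivity) N
      _ = _ := by rw [Real.exp_add]; ring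
  have hnum : ‖Complex.log (u + I * x) ^ n * cexp (-(s * Complex.log (u + I * x)))
      - Complex.log (u - I * x) ^ n * cexp (-(s * Complex.log (u - I * x)))‖ ≤
      ((1 + R) * n.factorial * (A ^ N * (N.factorial * Real.exp 1) * Real.exp x) * (1 / u * 2))
        * x := by
    refine (norm_pow_mul_exp_sub_le n hs ha hb).trans ?_
    rw [mul_assoc _ (1 / u * 2) x]
    gcongr
  refine (norm_div_exp_two_pi_mul_sub_one_le hx hnum).trans (le_of_eq ?_)
  have : Real.exp (-(Real.pi - 1) * x) = Real.exp x * Real.exp (-Real.pi * x) := by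
    rw [← Real.exp_add]; ring_nf
  rw [this]
  ring

theorem aestronglyMeasurable_hermiteKernel {u : ℝ} (hu : 0 < u) (n : ℕ) (s : ℂ) :
    AEStronglyMeasurable (hermiteKernel u n s) (volume.restrict (Ioi 0)) := by
  refine ContinuousOn.aestronglyMeasurable (fun x hx => ?_) measurableSet_Ioi
  have h1 : ContinuousAt (fun x : ℝ => Complex.log (u + I * x)) x :=
    ContinuousAt.clog (by fun_prop) (Or.inl (by simpa using hu))
  have h2 : ContinuousAt (fun x : ℝ => Complex.log (u - I * x)) x :=
    ContinuousAt.clog (by fun_prop) (Or.inl (by simpa using hu))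
  refine ContinuousAt.continuousWithinAt (ContinuousAt.div ?_ (by fun_prop)
    (exp_two_pi_mul_sub_one_ne_zero hx))
  fun_prop

theorem integrableOn_exp_neg_pi_sub_one (C : ℝ) :
    IntegrableOn (fun x : ℝ => C * Real.exp (-(Real.pi - 1) * x)) (Ioi 0) :=
  (integrableOn_exp_mul_Ioi (by linarith [Real.pi_gt_three]) 0).const_mul C

theorem integrableOn_hermiteKernel {u : ℝ} (hu : 0 < u) (n : ℕ) (s : ℂ) :
    IntegrableOn (hermiteKernel u n s) (Ioi 0) := by
  obtain ⟨C, hC⟩ := exists_norm_hermiteKernel_le hu n ‖s‖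
  refine Integrable.mono' (integrableOn_exp_neg_pi_sub_one C)
    (aestronglyMeasurable_hermiteKernel hu n s) ?_
  filter_upwards [ae_restrict_mem measurableSet_Ioi] with x hx
  exact hC s le_rfl x hx

theorem hasDerivAt_hermiteKernel (u : ℝ) (n : ℕ) (s : ℂ) (x : ℝ) :
    HasDerivAt (fun s => hermiteKernel u n s x) (-hermiteKernel u (n + 1) s x) s := by
  have h : ∀ w : ℂ, HasDerivAt (fun s : ℂ => w ^ n * cexp (-(s * w)))
      (w ^ n * (cexp (-(s * w)) * (-(1 * w)))) s := fun w =>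
    ((((hasDerivAt_id s).mul_const w).fun_neg).cexp).const_mul (w ^ n)
  convert! ((h (Complex.log (u + I * x))).sub (h (Complex.log (u - I * x)))).div_const
    (cexp (2 * Real.pi * x) - 1) using 1
  simp only [hermiteKernel]
  ring

theorem hasDerivAt_integral_hermiteKernel {u : ℝ} (hu : 0 < u) (n : ℕ) (s : ℂ) :
    HasDerivAt (fun s => ∫ x in Ioi 0, hermiteKernel u n s x)
      (-∫ x in Ioi 0, hermiteKernel u (n + 1) s x) s := by
  obtain ⟨C, hC⟩ := exists_norm_hermiteKernel_le hu (n + 1) (‖s‖ + 1)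
  rw [← integral_neg]
  refine (hasDerivAt_integral_of_dominated_loc_of_deriv_le
    (F' := fun s x => -hermiteKernel u (n + 1) s x)
    (Metric.ball_mem_nhds s one_pos)
    (Eventually.of_forall fun s => aestronglyMeasurable_hermiteKernel hu n s)
    (integrableOn_hermiteKernel hu n s) (aestronglyMeasurable_hermiteKernel hu (n + 1) s).neg
    ?_ (integrableOn_exp_neg_pi_sub_one C) ?_).2
  · filter_upwards [ae_restrict_mem measurableSet_Ioi] with x hx z hz
    rw [norm_neg]
    refine hC z ?_ x hx
    have h1 : ‖z - s‖ < 1 := by simpa [dist_eq_norm] using hz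
    linarith [norm_sub_norm_le z s]
  · exact Eventually.of_forall fun x z _ => hasDerivAt_hermiteKernel u n z x

theorem iteratedDeriv_eq_of_hasDerivAt {f : ℕ → ℂ → ℂ}
    (hf : ∀ n s, HasDerivAt (f n) (f (n + 1) s) s) (n : ℕ) : iteratedDeriv n (f 0) = f n := by
  induction n with
  | zero => exact iteratedDeriv_zero
  | succ n ih =>
    rw [iteratedDeriv_succ, ih]
    exact funext fun s => (hf n s).deriv

theorem iteratedDeriv_integral_hermiteKernel {u : ℝ} (hu : 0 < u) (n : ℕ) (s : ℂ) :
    iteratedDeriv n (fun s => ∫ x in Ioi 0, hermiteKernel u 0 s x) s =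
      (-1) ^ n * ∫ x in Ioi 0, hermiteKernel u n s x := by
  have h := iteratedDeriv_eq_of_hasDerivAt
    (f := fun n s => (-1) ^ n * ∫ x in Ioi 0, hermiteKernel u n s x) (fun n s => by
      convert! (hasDerivAt_integral_hermiteKernel hu n s).const_mul ((-1 : ℂ) ^ n) using 1
      ring) n
  simp only [pow_zero, one_mul] at h
  exact congrFun h s

/-! ### Hermite's formula -/

theorem hasSum_exp_neg_add (u : ℝ) {t : ℝ} (ht : 0 < t) :
    HasSum (fun k : ℕ => (1 : ℂ) * (Real.exp (-((k : ℝ) + u) * t) : ℝ))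
      (cexp (-(u * t)) / (1 - cexp (-t))) := by
  have hq1 : ‖cexp (-(t : ℂ))‖ < 1 := by
    rw [Complex.norm_exp]
    simpa using ht
  convert! (hasSum_geometric_of_norm_lt_one hq1).mul_left (cexp (-(u * t))) using 1
  funext k
  rw [← Complex.exp_nat_mul, ← Complex.exp_add, one_mul]
  push_cast
  congr 1
  ring

theorem Gamma_mul_hurwitzZetaReal {u : ℝ} (hu : 0 < u) {s : ℂ} (hs : 1 < s.re) :
    Gamma s * hurwitzZetaReal u s =
      ∫ t : ℝ in Ioi 0, (t : ℂ) ^ (s - 1) * (cexp (-(u * t)) / (1 - cexp (-t))) := by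
  have h1 := (hasSum_hurwitzZetaReal hu hs).mul_left (Gamma s)
  have h2 := hasSum_mellin (a := fun _ : ℕ => 1) (p := fun k : ℕ => (k : ℝ) + u) (s := s)
    (fun k => Or.inr (by positivity)) (by linarith) (fun t ht => hasSum_exp_neg_add u ht) (by
      refine ((Real.summable_one_div_nat_add_rpow u s.re).2 hs).congr fun k => ?_
      rw [norm_one, abs_of_pos (by positivity : 0 < (k : ℝ) + u)])
  have h3 : (fun k : ℕ => Gamma s * (1 / ((k : ℂ) + u) ^ s)) =
      fun k : ℕ => Gamma s * 1 / (((k : ℝ) + u : ℝ) : ℂ) ^ s := by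
    funext k
    push_cast
    ring
  rw [h3] at h1
  exact h1.unique h2

/-- This justifies Fubini: |sin(tx)| ≤ tx yields the product majorant t^(Re s) e^(-ut) · e^(-πx). -/
theorem integrable_cpow_mul_exp_mul_sin_div {u : ℝ} (hu : 0 < u) {s : ℂ} (hs : 0 < s.re) :
    Integrable (Function.uncurry fun t x : ℝ => (t : ℂ) ^ (s - 1) * cexp (-(u * t)) *
        (Complex.sin (t * x) / (cexp (2 * Real.pi * x) - 1)))
      ((volume.restrict (Ioi 0)).prod (volume.restrict (Ioi 0))) := by
  have h1 : IntegrableOn (fun t : ℝ => t ^ s.re * Real.exp (-u * t)) (Ioi 0) :=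
    integrableOn_rpow_mul_exp_neg (by linarith) hu
  have h2 : IntegrableOn (fun x : ℝ => Real.exp (-Real.pi * x)) (Ioi 0) :=
    integrableOn_exp_mul_Ioi (by linarith [Real.pi_pos]) 0
  refine Integrable.mono' (h1.mul_prod h2) ?_ ?_
  · rw [Measure.prod_restrict]
    refine ContinuousOn.aestronglyMeasurable (fun p hp => ?_)
      (measurableSet_Ioi.prod measurableSet_Ioi)
    have hp1 : ContinuousAt (fun p : ℝ × ℝ => (p.1 : ℂ) ^ (s - 1)) p :=
      (Complex.continuousAt_ofReal_cpow_const p.1 (s - 1) (Or.inr (ne_of_gt hp.1))).comp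
        continuousAt_fst
    have hp2 : ContinuousAt
        (fun p : ℝ × ℝ => Complex.sin (p.1 * p.2) / (cexp (2 * Real.pi * p.2) - 1)) p :=
      ContinuousAt.div (by fun_prop) (by fun_prop) (exp_two_pi_mul_sub_one_ne_zero hp.2)
    exact ((hp1.mul (by fun_prop)).mul hp2).continuousWithinAt
  · rw [Measure.prod_restrict]
    filter_upwards [ae_restrict_mem (measurableSet_Ioi.prod measurableSet_Ioi)] with p hp
    have hp1 : 0 < p.1 := hp.1
    have h3 := norm_div_exp_two_pi_mul_sub_one_le hp.2 (norm_sin_ofReal_mul_le hp1 hp.2)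
    have h4 := norm_ofReal_cpow_mul_exp (s - 1) u hp1
    simp only [Function.uncurry]
    rw [norm_mul, h4]
    refine (mul_le_mul_of_nonneg_left h3 (by positivity)).trans (le_of_eq ?_)
    rw [sub_re, one_re, Real.rpow_sub_one hp1.ne', ofReal_re]
    field_simp

theorem integral_cpow_mul_exp_mul_sin {u : ℝ} (hu : 0 < u) {s : ℂ} (hs : 0 < s.re) (x : ℝ) :
    ∫ t : ℝ in Ioi 0, (t : ℂ) ^ (s - 1) * cexp (-(u * t)) * Complex.sin (t * x) =
      I / 2 * Gamma s * (cexp (-(s * Complex.log (u + I * x)))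
        - cexp (-(s * Complex.log (u - I * x)))) := by
  have h1 : 0 < (u + I * x : ℂ).re := by simpa using hu
  have h2 : 0 < (u - I * x : ℂ).re := by simpa using hu
  have hs' : -1 < (s - 1).re := by simpa using hs
  have h : ∀ t : ℝ, (t : ℂ) ^ (s - 1) * cexp (-(u * t)) * Complex.sin (t * x) =
      I / 2 * ((t : ℂ) ^ (s - 1) * cexp (-((u + I * x) * t))
        - (t : ℂ) ^ (s - 1) * cexp (-((u - I * x) * t))) := fun t => by
    have := sin_mul_exp_neg_eq x u t
    rw [neg_mul, neg_mul] at this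
    rw [mul_comm (t : ℂ) x]
    linear_combination (t : ℂ) ^ (s - 1) * this
  simp_rw [h]
  rw [integral_const_mul, integral_sub (integrableOn_cpow_mul_exp_neg hs' h1)
    (integrableOn_cpow_mul_exp_neg hs' h2), integral_cpow_mul_exp_neg_mul_complex hs h1,
    integral_cpow_mul_exp_neg_mul_complex hs h2]
  ring

theorem integral_cpow_mul_exp_mul_integral_sin {u : ℝ} (hu : 0 < u) {s : ℂ} (hs : 0 < s.re) :
    ∫ t : ℝ in Ioi 0, ∫ x : ℝ in Ioi 0, (t : ℂ) ^ (s - 1) * cexp (-(u * t)) *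
        (Complex.sin (t * x) / (cexp (2 * Real.pi * x) - 1)) =
      I / 2 * Gamma s * ∫ x in Ioi 0, hermiteKernel u 0 s x := by
  rw [integral_integral_swap (integrable_cpow_mul_exp_mul_sin_div hu hs), ← integral_const_mul]
  congr 1
  funext x
  simp_rw [← mul_div_assoc]
  rw [integral_div, integral_cpow_mul_exp_mul_sin hu hs]
  simp only [hermiteKernel, pow_zero, one_mul, mul_div_assoc]

/-- Hermite's formula for the Hurwitz zeta function in the half-plane `1 < re s`. -/
theorem hurwitzZetaReal_eq_hermite {u : ℝ} (hu : 0 < u) {s : ℂ} (hs : 1 < s.re) :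
    hurwitzZetaReal u s = cexp (-(s * Real.log u)) / 2
      + cexp (-((s - 1) * Real.log u)) / (s - 1)
      + I * ∫ x in Ioi 0, hermiteKernel u 0 s x := by
  have hs0 : 0 < s.re := by linarith
  have hs1 : 0 < (s - 1).re := by simpa using hs
  have hs1' : s - 1 ≠ 0 := fun h => by simp [h] at hs1
  have hu' : 0 < (u : ℂ).re := hu
  have hG : Gamma s = (s - 1) * Gamma (s - 1) := by
    have := Complex.Gamma_add_one (s - 1) hs1'
    rwa [sub_add_cancel] at this
  have hG0 : Gamma s ≠ 0 := Complex.Gamma_ne_zero_of_re_pos hs0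
  have i1 := (integrableOn_cpow_mul_exp_neg (a := s - 1) (r := u) (by linarith) hu').const_mul
    (1 / 2)
  -- The 1/t term of Legendre's formula; integrability of t^(s-2) near 0 is where Re s > 1 is
  -- needed.
  have i2 := integrableOn_cpow_mul_exp_neg (a := s - 1 - 1) (r := u)
    (by rw [sub_re, one_re]; linarith) hu'
  have i12 : IntegrableOn (fun t : ℝ => 1 / 2 * ((t : ℂ) ^ (s - 1) * cexp (-(u * t)))
      + (t : ℂ) ^ (s - 1 - 1) * cexp (-(u * t))) (Ioi 0) := i1.add i2
  have i3 : IntegrableOn (fun t : ℝ => 2 * ∫ x : ℝ in Ioi 0, (t : ℂ) ^ (s - 1) * cexp (-(u * t)) *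
        (Complex.sin (t * x) / (cexp (2 * Real.pi * x) - 1))) (Ioi 0) :=
    (integrable_cpow_mul_exp_mul_sin_div hu hs0).integral_prod_left.const_mul 2
  have key := Gamma_mul_hurwitzZetaReal hu hs
  -- Legendre's integral, solved for 1/(1-e^(-t)).
  rw [setIntegral_congr_fun (g := fun t : ℝ =>
    1 / 2 * ((t : ℂ) ^ (s - 1) * cexp (-(u * t))) + (t : ℂ) ^ (s - 1 - 1) * cexp (-(u * t))
      + 2 * ∫ x : ℝ in Ioi 0, (t : ℂ) ^ (s - 1) * cexp (-(u * t)) *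
        (Complex.sin (t * x) / (cexp (2 * Real.pi * x) - 1))) measurableSet_Ioi ?_,
    integral_add i12 i3, integral_add i1 i2, integral_const_mul, integral_const_mul,
    integral_cpow_mul_exp_neg_mul_complex hs0 hu', integral_cpow_mul_exp_neg_mul_complex hs1 hu',
    integral_cpow_mul_exp_mul_integral_sin hu hs0, ← ofReal_log hu.le] at key
  · refine mul_left_cancel₀ hG0 (key.trans ?_)
    have : Gamma (s - 1) = Gamma s / (s - 1) := by rw [hG]; field_simp
    rw [this]
    ring
  · intro t ht
    have ht0 : (t : ℂ) ≠ 0 := ofReal_ne_zero.2 (ne_of_gt ht)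
    have hq1 : ‖cexp (-(t : ℂ))‖ < 1 := by
      rw [Complex.norm_exp]
      simpa using ht
    have hne : 1 - cexp (-(t : ℂ)) ≠ 0 := sub_ne_zero.2 fun h => by simp [← h] at hq1
    simp only
    rw [integral_const_mul, integral_sin_div_exp_sub_one ht, cpow_sub (s - 1) 1 ht0, cpow_sub s 1 ht0, cpow_one]
    field_simp
    ring

/-- Hermite's formula, cleared of its pole, on the whole plane. -/
theorem sub_one_mul_hurwitzZetaRegular {u : ℝ} (hu : 0 < u) (s : ℂ) :
    (s - 1) * (hurwitzZetaRegular u s - cexp (-(s * Real.log u)) / 2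
      - I * ∫ x in Ioi 0, hermiteKernel u 0 s x) = cexp (-((s - 1) * Real.log u)) - 1 := by
  have hH : Differentiable ℂ fun s : ℂ => ∫ x in Ioi 0, hermiteKernel u 0 s x :=
    fun s => (hasDerivAt_integral_hermiteKernel hu 0 s).differentiableAt
  have hR := differentiable_hurwitzZetaRegular u
  have h1 : AnalyticOnNhd ℂ (fun s : ℂ => (s - 1) * (hurwitzZetaRegular u s
      - cexp (-(s * Real.log u)) / 2 - I * ∫ x in Ioi 0, hermiteKernel u 0 s x)) univ :=
    DifferentiableOn.analyticOnNhd (Differentiable.differentiableOn (by fun_prop)) isOpen_univ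
  have h2 : AnalyticOnNhd ℂ (fun s : ℂ => cexp (-((s - 1) * Real.log u)) - 1) univ :=
    DifferentiableOn.analyticOnNhd (Differentiable.differentiableOn (by fun_prop)) isOpen_univ
  -- Both sides are entire, so agreement near 2 suffices.
  refine congrFun (h1.eq_of_eventuallyEq h2 (z₀ := 2) ?_) s
  have ho : IsOpen {z : ℂ | 1 < z.re} := isOpen_lt continuous_const continuous_re
  filter_upwards [ho.mem_nhds (show (2 : ℂ) ∈ {z : ℂ | 1 < z.re} by simp)] with z hz
  have hz1 : z ≠ 1 := fun h => by simp [h] at hz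
  have hz0 : z - 1 ≠ 0 := sub_ne_zero.2 hz1
  have h3 : hurwitzZetaRegular u z = hurwitzZetaReal u z - 1 / (z - 1) := by
    simp [hurwitzZetaRegular, Function.update_of_ne hz1]
  rw [h3, hurwitzZetaReal_eq_hermite hu hz]
  field_simp
  ring

/-! ### Taylor coefficients at s = 1 -/

/-- In Leibniz's rule only the terms with s - a differentiated at most once remain, and at s = a
only those with it differentiated exactly once. -/
theorem iteratedDeriv_succ_sub_mul {f : ℂ → ℂ} (hf : Differentiable ℂ f) (a : ℂ) (n : ℕ) :
    iteratedDeriv (n + 1) (fun s => (s - a) * f s) a = (n + 1) * iteratedDeriv n f a := by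
  have hd : ∀ n s, HasDerivAt (iteratedDeriv n f) (iteratedDeriv (n + 1) f s) s := fun n s => by
    rw [iteratedDeriv_succ]
    exact ((hf.contDiff (n := ⊤)).differentiable_iteratedDeriv n
      (by exact_mod_cast WithTop.coe_lt_top _) s).hasDerivAt
  have h := iteratedDeriv_eq_of_hasDerivAt
    -- At n = 0 the truncated index n - 1 is harmless: its coefficient is 0.
    (f := fun n s => (s - a) * iteratedDeriv n f s + n * iteratedDeriv (n - 1) f s)
    (fun n s => by
      rcases n with _ | n
      · convert! (((hasDerivAt_id s).sub_const a).mul (hd 0 s)) using 1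
        · funext y
          simp
        · simp [add_comm]
      · convert! (((hasDerivAt_id s).sub_const a).mul (hd (n + 1) s)).add
          ((hd n s).const_mul ((n : ℂ) + 1)) using 1
        · funext y
          simp
        · simp only [Nat.add_sub_cancel, id]
          push_cast
          ring) (n + 1)
  simp only [iteratedDeriv_zero, Nat.cast_zero, zero_mul, add_zero] at h
  simpa using congrFun h a

theorem iteratedDeriv_exp_neg_mul (l c : ℂ) (n : ℕ) (s : ℂ) :
    iteratedDeriv n (fun s => cexp (-((s - c) * l))) s = (-l) ^ n * cexp (-((s - c) * l)) := by
  have h := iteratedDeriv_eq_of_hasDerivAt (f := fun n s => (-l) ^ n * cexp (-((s - c) * l)))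
    (fun n s => by
      have h : HasDerivAt (fun s : ℂ => -((s - c) * l)) (-(1 * l)) s :=
        (((hasDerivAt_id s).sub_const c).mul_const l).fun_neg
      convert! h.cexp.const_mul ((-l) ^ n) using 1
      ring) n
  simp only [pow_zero, one_mul] at h
  exact congrFun h s

theorem stieltjesConst_eq_hermite {u : ℝ} (hu : 0 < u) (n : ℕ) :
    stieltjesConst n u = (Real.log u : ℂ) ^ n / (2 * u) - (Real.log u : ℂ) ^ (n + 1) / (n + 1)
      + I * ∫ x in Ioi 0, hermiteKernel u n 1 x := by
  have hH : Differentiable ℂ fun s : ℂ => ∫ x in Ioi 0, hermiteKernel u 0 s x :=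
    fun s => (hasDerivAt_integral_hermiteKernel hu 0 s).differentiableAt
  have hR := differentiable_hurwitzZetaRegular u
  set l : ℂ := (Real.log u : ℂ) with hl
  -- The form s - 0 matches `iteratedDeriv_exp_neg_mul` with c = 0.
  have hE : Differentiable ℂ fun s : ℂ => cexp (-((s - 0) * l)) := by fun_prop
  -- `D` is the entire extension of (u^(1-s) - 1)/(s-1); it supplies the term in log^(n+1) u.
  set D : ℂ → ℂ := fun s => hurwitzZetaRegular u s - cexp (-(s * l)) / 2
      - I * ∫ x in Ioi 0, hermiteKernel u 0 s x with hD
  have hDd : Differentiable ℂ D := by fun_prop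
  have h1 := iteratedDeriv_succ_sub_mul hDd 1 n
  have h2 : (fun s => (s - 1) * D s) = fun s => cexp (-((s - 1) * l)) - 1 :=
    funext (sub_one_mul_hurwitzZetaRegular hu)
  have h3 : iteratedDeriv (n + 1) (fun s : ℂ => cexp (-((s - 1) * l)) - 1) 1 = (-l) ^ (n + 1) := by
    have hd : deriv (fun s : ℂ => cexp (-((s - 1) * l)) - 1)
        = deriv fun s : ℂ => cexp (-((s - 1) * l)) := by
      funext s
      simp
    rw [iteratedDeriv_succ', hd, ← iteratedDeriv_succ', iteratedDeriv_exp_neg_mul]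
    simp
  rw [h2, h3] at h1
  have h4 : hurwitzZetaRegular u = fun s => D s + ((1 / 2) * cexp (-((s - 0) * l))
      + I * ∫ x in Ioi 0, hermiteKernel u 0 s x) := by
    funext s
    simp only [hD, sub_zero]
    ring
  have hexp : cexp l = u := by rw [hl, ← ofReal_exp, Real.exp_log hu]
  have hu0 : (u : ℂ) ≠ 0 := ofReal_ne_zero.2 hu.ne'
  have h5 : iteratedDeriv n (hurwitzZetaRegular u) 1 = iteratedDeriv n D 1
      + (1 / 2 * ((-l) ^ n * cexp (-l)) + I * ((-1) ^ n * ∫ x in Ioi 0, hermiteKernel u n 1 x)) := by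
    have c1 : ContDiffAt ℂ n D 1 := hDd.contDiff.contDiffAt
    have c2 : ContDiffAt ℂ n (fun s : ℂ => (1 / 2) * cexp (-((s - 0) * l))) 1 :=
      (hE.const_mul (1 / 2)).contDiff.contDiffAt
    have c3 : ContDiffAt ℂ n (fun s : ℂ => I * ∫ x in Ioi 0, hermiteKernel u 0 s x) 1 :=
      (hH.const_mul I).contDiff.contDiffAt
    rw [h4, iteratedDeriv_fun_add c1 (c2.add c3), iteratedDeriv_fun_add c2 c3,
      iteratedDeriv_const_mul_field, iteratedDeriv_const_mul_field, iteratedDeriv_exp_neg_mul,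
      iteratedDeriv_integral_hermiteKernel hu, sub_zero, one_mul]
  have hn : (n : ℂ) + 1 ≠ 0 := Nat.cast_add_one_ne_zero n
  have h6 : iteratedDeriv n D 1 = (-l) ^ (n + 1) / (n + 1) := by
    rw [eq_div_iff hn, h1]
    ring
  rw [stieltjesConst, h5, h6, Complex.exp_neg, hexp, neg_pow l, neg_pow l]
  have hsq : ((-1 : ℂ) ^ n) * (-1) ^ n = 1 := by
    rw [← mul_pow]
    simp
  rw [pow_succ (-1 : ℂ)]
  linear_combination (l ^ n / (2 * u) - l ^ (n + 1) / (n + 1)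
    + I * ∫ x in Ioi 0, hermiteKernel u n 1 x) * hsq

/-- At s = 1 the exponentials become 1/(u ± ix) = (u ∓ ix)/(u² + x²). -/
theorem hermiteKernel_one {u : ℝ} (hu : 0 < u) (n : ℕ) (x : ℝ) :
    hermiteKernel u n 1 x =
      (((u : ℂ) - I * x) * Complex.log (u + I * x) ^ n
          - ((u : ℂ) + I * x) * Complex.log (u - I * x) ^ n)
        / (((u : ℂ) ^ 2 + (x : ℂ) ^ 2) * (Complex.exp (2 * Real.pi * x) - 1)) := by
  have h1 : (u + I * x : ℂ) ≠ 0 := fun h => hu.ne' (by simpa using congrArg re h)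
  have h2 : (u - I * x : ℂ) ≠ 0 := fun h => hu.ne' (by simpa using congrArg re h)
  have h3 : ((u : ℂ) ^ 2 + (x : ℂ) ^ 2) = (u + I * x) * (u - I * x) := by
    linear_combination (x : ℂ) ^ 2 * I_sq
  rw [hermiteKernel, h3, ← div_div, one_mul, one_mul, Complex.exp_neg, Complex.exp_neg,
    Complex.exp_log h1, Complex.exp_log h2]
  congr 1
  field_simp

theorem mainTheorem3 (u : ℝ) (hu : 0 < u) (n : ℕ) :
    IntegrableOn (fun x : ℝ =>
        (((u : ℂ) - I * x) * Complex.log (u + I * x) ^ n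
            - ((u : ℂ) + I * x) * Complex.log (u - I * x) ^ n)
          / (((u : ℂ) ^ 2 + (x : ℂ) ^ 2) * (Complex.exp (2 * Real.pi * x) - 1))) (Ioi 0) ∧
    stieltjesConst n u =
      (Real.log u : ℂ) ^ n / (2 * u) - (Real.log u : ℂ) ^ (n + 1) / (n + 1)
        + I * ∫ x : ℝ in Ioi 0,
            (((u : ℂ) - I * x) * Complex.log (u + I * x) ^ n
                - ((u : ℂ) + I * x) * Complex.log (u - I * x) ^ n)
              / (((u : ℂ) ^ 2 + (x : ℂ) ^ 2) * (Complex.exp (2 * Real.pi * x) - 1)) := by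
  simp_rw [← hermiteKernel_one hu n]
  exact ⟨integrableOn_hermiteKernel hu n 1, stieltjesConst_eq_hermite hu n⟩
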